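/- Let $M$ be a smooth $n$-dimensional manifold, $\pi:N=TM\setminus 0\to M$ its slit tangent bundle, and let $F:TM\to[0,\infty)$ be a Finsler structure on $M$: $F$ is smooth on $N$, $F(x,\lambda y)=\lambda F(x,y)$ for all $\lambda>0$, and, in natural coordinates $(x^i,y^i)$, the matrix $g_{ij}(x,y)=\frac12\,\partial^2F^2/\partial y^i\partial y^j$ is positive definite on $N$. The indicatrix at $x\in M$ is $I_x=\{y\in T_xM : F(x,y)=1\}$. Suppose that there is a Riemannian metric $h$ on $M$ such that the parallel transport of the pull-back $\pi^*\nabla^h$ of its Levi-Civita connection $\nabla^h$ to the bundle $\pi^*TM\to N$ leaves the indicatrix of $F$ invariant: for every smooth path $c:[0,1]\to N$ with $\pi(c(0))=x$ and $\pi(c(1))=z$, parallel transport along $c$, viewed as a map $T_xM\to T_zM$, maps $I_x$ to $I_z$. Here $\pi^*\nabla^h$ is the connection whose connection forms in natural coordinates are $\Gamma^i_{jk}(x)\,dx^k$, where $\Gamma^i_{jk}$ are the Christoffel symbols of $h$. Then $(M,F)$ is a Berwald space, that is, in all natural coordinates the coefficients of the Chern connection do not depend on $y$: $\omega^i_j=\Gamma^i_{jk}(x)\,dx^k$.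 The Chern connection is the linear connection on $\pi^*TM\to N$ whose connection forms $\omega^i_j$ are determined by $$dx^j\wedge\omega^i_j=0,\qquad dg_{ij}-g_{kj}\,\omega^k_i-g_{ik}\,\omega^k_j=2A_{ijk}\,\frac{\delta y^k}{F},$$ where $A_{ijk}=\frac F2\,\partial g_{ij}/\partial y^k$, $\ \delta y^i=dy^i+N^i_j\,dx^j$, $\ \frac{N^i_j}{F}=\gamma^i_{jk}\frac{y^k}{F}-A^i_{jk}\gamma^k_{rs}\frac{y^r}{F}\frac{y^s}{F}$, $\ A^i_{jk}=g^{il}A_{ljk}$ and $\gamma^i_{jk}=\frac12 g^{is}\left(\frac{\partial g_{sj}}{\partial x^k}-\frac{\partial g_{jk}}{\partial x^s}+\frac{\partial g_{sk}}{\partial x^j}\right)$. -/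

import Mathlib

open scoped Manifold ContDiff
open Bundle Set

namespace FinslerGeometry

/-- The space `ℝⁿ` in which local coordinates take their values. -/
abbrev Coord (n : ℕ) : Type := EuclideanSpace ℝ (Fin n)

/-! ### Calculus in natural coordinates `(x, y)`

A point of the tangent bundle has natural coordinates `p = (x, y) : Coord n × Coord n`. A tangent
vector of the tangent bundle at that point has components `Z = (X, Y) : Coord n × Coord n`, meaning
`X^k ∂/∂x^k + Y^k ∂/∂y^k`. -/

section Local

variable {n : ℕ}

/-- The partial derivative `∂f/∂x^k` of a function of `(x, y)`. -/
noncomputable def pdx (k : Fin n) (f : Coord n × Coord n → ℝ) (p : Coord n × Coord n) : ℝ :=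
  fderiv ℝ f p (EuclideanSpace.single k 1, 0)

/-- The partial derivative `∂f/∂y^k` of a function of `(x, y)`. -/
noncomputable def pdy (k : Fin n) (f : Coord n × Coord n → ℝ) (p : Coord n × Coord n) : ℝ :=
  fderiv ℝ f p (0, EuclideanSpace.single k 1)

/-- The coordinate one-form `dx^k` on the tangent bundle. -/
noncomputable def dx (k : Fin n) : Coord n × Coord n →L[ℝ] ℝ :=
  (EuclideanSpace.proj k).comp (ContinuousLinearMap.fst ℝ (Coord n) (Coord n))

/-- The coordinate one-form `dy^k` on the tangent bundle. -/
noncomputable def dy (k : Fin n) : Coord n × Coord n →L[ℝ] ℝ :=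
  (EuclideanSpace.proj k).comp (ContinuousLinearMap.snd ℝ (Coord n) (Coord n))

/-- The matrix `g_ij = (1/2) ∂²L²/∂y^i∂y^j` of the fundamental tensor of a Finsler function that
reads `L` in natural coordinates. -/
noncomputable def fundamentalMatrix (L : Coord n × Coord n → ℝ) (p : Coord n × Coord n) :
    Matrix (Fin n) (Fin n) ℝ :=
  Matrix.of fun i j => (1 / 2) * pdy i (pdy j fun q => L q ^ 2) p

/-- The components `A_ijk = (L/2) ∂g_ij/∂y^k` of the Cartan tensor. -/
noncomputable def cartan (L : Coord n × Coord n → ℝ) (p : Coord n × Coord n)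
    (i j k : Fin n) : ℝ :=
  L p / 2 * pdy k (fun q => fundamentalMatrix L q i j) p

/-- `A^i_jk = g^il A_ljk`. -/
noncomputable def cartanUp (L : Coord n × Coord n → ℝ) (p : Coord n × Coord n)
    (i j k : Fin n) : ℝ :=
  ∑ l, (fundamentalMatrix L p)⁻¹ i l * cartan L p l j k

/-- The formal Christoffel symbols
`γ^i_jk = (1/2) g^is (∂g_sj/∂x^k - ∂g_jk/∂x^s + ∂g_sk/∂x^j)` of the fundamental tensor. -/
noncomputable def formalChristoffel (L : Coord n × Coord n → ℝ) (p : Coord n × Coord n)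
    (i j k : Fin n) : ℝ :=
  (1 / 2) * ∑ s, (fundamentalMatrix L p)⁻¹ i s *
    (pdx k (fun q => fundamentalMatrix L q s j) p - pdx s (fun q => fundamentalMatrix L q j k) p
      + pdx j (fun q => fundamentalMatrix L q s k) p)

/-- The coefficients of the nonlinear connection, given by
`N^i_j / L = γ^i_jk y^k / L - A^i_jk γ^k_rs (y^r / L) (y^s / L)`. -/
noncomputable def nonlinearConnection (L : Coord n × Coord n → ℝ) (p : Coord n × Coord n)
    (i j : Fin n) : ℝ :=
  L p * (∑ k, formalChristoffel L p i j k * (p.2 k / L p)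
    - ∑ k, ∑ r, ∑ s,
        cartanUp L p i j k * formalChristoffel L p k r s * (p.2 r / L p) * (p.2 s / L p))

/-- The one-forms `δy^i / L = (dy^i + N^i_j dx^j) / L`. -/
noncomputable def deltaY (L : Coord n × Coord n → ℝ) (p : Coord n × Coord n) (i : Fin n) :
    Coord n × Coord n →L[ℝ] ℝ :=
  (L p)⁻¹ • (dy i + ∑ j, nonlinearConnection L p i j • dx j)

end Local

/-! ### The manifold -/

section Manifold

variable {n : ℕ} {M : Type*} [TopologicalSpace M] [ChartedSpace (Coord n) M]

/-- The natural coordinates `(x, y)` of a tangent vector induced by the local coordinates `φ`. -/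
noncomputable def natCoord (φ : OpenPartialHomeomorph M (Coord n))
    (v : TangentBundle (𝓡 n) M) : Coord n × Coord n :=
  (φ v.proj, mfderiv (𝓡 n) (𝓡 n) φ v.proj v.snd)

/-- The tangent vector with natural coordinates `(x, y)`. -/
noncomputable def natPoint (φ : OpenPartialHomeomorph M (Coord n))
    (p : Coord n × Coord n) : TangentBundle (𝓡 n) M :=
  ⟨φ.symm p.1, mfderiv (𝓡 n) (𝓡 n) φ.symm p.1 p.2⟩

/-- A function on the tangent bundle, read in natural coordinates. -/
noncomputable def inCoord (φ : OpenPartialHomeomorph M (Coord n))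
    (F : TangentBundle (𝓡 n) M → ℝ) (p : Coord n × Coord n) : ℝ :=
  F (natPoint φ p)

/-- The range of natural coordinates on the slit tangent bundle over the domain of `φ`. -/
def slitDomain (φ : OpenPartialHomeomorph M (Coord n)) : Set (Coord n × Coord n) :=
  {p | p.1 ∈ φ.target ∧ p.2 ≠ 0}

variable (n M) in
/-- The slit tangent bundle `N = TM ∖ 0`. -/
def slit : Set (TangentBundle (𝓡 n) M) := {v | v.snd ≠ 0}

/-- Finsler structures: nonnegative functions on `TM`, smooth on the slit tangent bundle,
positively homogeneous of degree one on each tangent space, and strongly convex. -/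
structure IsFinslerStructure [IsManifold (𝓡 n) ∞ M] (F : TangentBundle (𝓡 n) M → ℝ) : Prop where
  nonneg : ∀ v, 0 ≤ F v
  smooth : ContMDiffOn (𝓡 n).tangent 𝓘(ℝ, ℝ) ∞ F (slit n M)
  homogeneous : ∀ (x : M) (y : TangentSpace (𝓡 n) x) (r : ℝ), 0 < r →
    F (⟨x, r • y⟩ : TangentBundle (𝓡 n) M) = r * F (⟨x, y⟩ : TangentBundle (𝓡 n) M)
  stronglyConvex : ∀ φ ∈ IsManifold.maximalAtlas (𝓡 n) ∞ M, ∀ p ∈ slitDomain φ,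
    (fundamentalMatrix (inCoord φ F) p).PosDef

/-- The indicatrix `{y ∈ T_xM | F(x, y) = 1}`. -/
def indicatrix (F : TangentBundle (𝓡 n) M → ℝ) (x : M) : Set (TangentSpace (𝓡 n) x) :=
  {y | F (⟨x, y⟩ : TangentBundle (𝓡 n) M) = 1}

variable (n M) in
/-- The connection forms of a linear connection on `π*TM → N`, for each local coordinate system
`φ` of `M`: at the point with natural coordinates `p`, the one-form with upper index `i` and lower
index `j` is `θ φ p i j`, so that `∇_Z (π*∂_j) = θ^i_j(Z) π*∂_i`. -/
abbrev ConnectionForms : Type _ :=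
  OpenPartialHomeomorph M (Coord n) → Coord n × Coord n → Fin n → Fin n →
    (Coord n × Coord n →L[ℝ] ℝ)

/-- The structure equations that characterize the Chern connection (they have exactly one
solution on the slit tangent bundle over each chart domain): vanishing torsion
`d(dx^i) - dx^j ∧ θ^i_j = 0` (where `d(dx^i) = 0`), and almost `g`-compatibility
`dg_ij - g_kj θ^k_i - g_ik θ^k_j = 2 A_ijk δy^k / F`. -/
structure IsChernConnection [IsManifold (𝓡 n) ∞ M] (F : TangentBundle (𝓡 n) M → ℝ)
    (θ : ConnectionForms n M) : Prop where
  torsion_free : ∀ φ ∈ IsManifold.maximalAtlas (𝓡 n) ∞ M, ∀ p ∈ slitDomain φ,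
    ∀ (i : Fin n) (Z W : Coord n × Coord n),
      ∑ j, (dx j Z * θ φ p i j W - dx j W * θ φ p i j Z) = 0
  almost_compatible : ∀ φ ∈ IsManifold.maximalAtlas (𝓡 n) ∞ M, ∀ p ∈ slitDomain φ,
    ∀ i j : Fin n,
      fderiv ℝ (fun q => fundamentalMatrix (inCoord φ F) q i j) p
        - ∑ k, fundamentalMatrix (inCoord φ F) p k j • θ φ p k i
        - ∑ k, fundamentalMatrix (inCoord φ F) p i k • θ φ p k j
      = ∑ k, (2 * cartan (inCoord φ F) p i j k) • deltaY (inCoord φ F) p k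

/-- The structure is Berwald: the coefficients of the Chern connection in natural coordinates live
on `M`, that is, `θ^i_j(x, y) = Γ^i_jk(x) dx^k` with `Γ^i_jk` not depending on `y`. -/
def IsBerwald [IsManifold (𝓡 n) ∞ M] (F : TangentBundle (𝓡 n) M → ℝ) : Prop :=
  ∃ θ : ConnectionForms n M, IsChernConnection F θ ∧
    ∀ φ ∈ IsManifold.maximalAtlas (𝓡 n) ∞ M, ∃ Γ : Coord n → Fin n → Fin n → Fin n → ℝ,
      ∀ p ∈ slitDomain φ, ∀ i j : Fin n, θ φ p i j = ∑ k, Γ p.1 i j k • dx k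

variable (n M) in
/-- Smooth Riemannian metrics on `M`. -/
abbrev Metric [IsManifold (𝓡 n) ∞ M] : Type _ :=
  ContMDiffRiemannianMetric (𝓡 n) ∞ (Coord n) (fun x : M => TangentSpace (𝓡 n) x)

/-- The components `h_ij(x)` of a Riemannian metric in local coordinates. -/
noncomputable def metricMatrix [IsManifold (𝓡 n) ∞ M] (h : Metric n M)
    (φ : OpenPartialHomeomorph M (Coord n)) (x : Coord n) : Matrix (Fin n) (Fin n) ℝ :=
  Matrix.of fun i j => h.inner (φ.symm x)
    (mfderiv (𝓡 n) (𝓡 n) φ.symm x (EuclideanSpace.single i (1 : ℝ) : Coord n))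
    (mfderiv (𝓡 n) (𝓡 n) φ.symm x (EuclideanSpace.single j (1 : ℝ) : Coord n))

/-- The coefficients `Γ^i_jk = (1/2) h^is (∂_k h_sj - ∂_s h_jk + ∂_j h_sk)` of the Levi-Civita
connection of `h` in local coordinates. -/
noncomputable def leviCivita [IsManifold (𝓡 n) ∞ M] (h : Metric n M)
    (φ : OpenPartialHomeomorph M (Coord n)) (x : Coord n) (i j k : Fin n) : ℝ :=
  (1 / 2) * ∑ s, (metricMatrix h φ x)⁻¹ i s *
    (fderiv ℝ (fun z => metricMatrix h φ z s j) x (EuclideanSpace.single k 1)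
      - fderiv ℝ (fun z => metricMatrix h φ z j k) x (EuclideanSpace.single s 1)
      + fderiv ℝ (fun z => metricMatrix h φ z s k) x (EuclideanSpace.single j 1))

/-- The pull-back `π*∇^h` of the Levi-Civita connection to `π*TM → N`. Its connection forms are the
pull-backs along `(x, y) ↦ x` of the Levi-Civita ones. -/
noncomputable def pullbackLeviCivita [IsManifold (𝓡 n) ∞ M] (h : Metric n M) :
    ConnectionForms n M :=
  fun φ p i j => ∑ k, leviCivita h φ p.1 i j k • dx k

/-- The section `ξ` of `π*TM` along the path `c : [0, 1] → N` is parallel: its components satisfy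
`dξ^i/dt + θ^i_j(dc/dt) ξ^j = 0` at every time `t`. The equation does not depend on the local
coordinates, so it is stated in some local coordinates around `π (c t)`. -/
def IsParallelAlong [IsManifold (𝓡 n) ∞ M] (θ : ConnectionForms n M)
    (c : ℝ → TangentBundle (𝓡 n) M) (ξ : ∀ t : ℝ, TangentSpace (𝓡 n) (c t).proj) : Prop :=
  ∀ t ∈ Icc (0 : ℝ) 1, ∃ φ ∈ IsManifold.maximalAtlas (𝓡 n) ∞ M, (c t).proj ∈ φ.source ∧
    HasDerivWithinAt (fun s => (natCoord φ ⟨(c s).proj, ξ s⟩).2)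
      (WithLp.toLp 2 fun i => -∑ j, θ φ (natCoord φ (c t)) i j
          (derivWithin (fun s => natCoord φ (c s)) (Icc 0 1) t)
        * (natCoord φ ⟨(c t).proj, ξ t⟩).2 j)
      (Icc 0 1) t

/-- Parallel transport in `π*TM` along every smooth path `c : [0, 1] → N` maps the indicatrix of the
initial point into that of the final point (hence onto it, as the reversed path shows). -/
def LeavesIndicatrixInvariant [IsManifold (𝓡 n) ∞ M] (F : TangentBundle (𝓡 n) M → ℝ)
    (θ : ConnectionForms n M) : Prop :=
  ∀ (c : ℝ → TangentBundle (𝓡 n) M) (ξ : ∀ t : ℝ, TangentSpace (𝓡 n) (c t).proj),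
    ContMDiffOn 𝓘(ℝ, ℝ) (𝓡 n).tangent ∞ c (Icc 0 1) →
    (∀ t ∈ Icc (0 : ℝ) 1, c t ∈ slit n M) →
    IsParallelAlong θ c ξ →
    ξ 0 ∈ indicatrix F (c 0).proj → ξ 1 ∈ indicatrix F (c 1).proj

end Manifold

end FinslerGeometry

/-! The pull-back of the Levi-Civita connection is itself a Chern connection of `F`. `IsBerwald`
asks only for some solution of the structure equations with coefficients on `M`, so exhibiting this
one suffices and uniqueness plays no role.

Write Γ for the Levi-Civita coefficients in a chart. Solve the equation of parallel fields over a
coordinate line (`exists_parallel_curve`). Invariance of the indicatrix, extended to all level sets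
by homogeneity, makes `F` constant along the solution (`inCoord_parallel_eq`). Differentiating at
time zero shows that horizontal vectors annihilate F², that is, ∂F²/∂x^k = Γ^l_rk y^r ∂F²/∂y^l
(`pdx_sq_eq`).

As Γ depends on x alone, two vertical derivatives of this identity express ∂g_ij/∂x^k through Γ, g
and Γ^l_rk y^r ∂g_ij/∂y^l (`pdx_fundamentalMatrix`). This is the dx-part of almost compatibility as
soon as N^i_j = Γ^i_rj y^r, which is `nonlinearConnection_eq`, a computation with Euler's
identities; the dy-part is the definition of the Cartan tensor. Vanishing torsion is the symmetry of
Γ in its lower indices. -/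

namespace FinslerGeometry

/-! ### Partial derivatives in natural coordinates. -/

section Calculus

variable {n : ℕ}

/-- A vertical derivative only sees the fibre through `p`. This allows Γ to be frozen at the base
point: the horizontal identity with constant Γ holds on a single fibre and not on an open set. -/
theorem pdy_congr_of_eq_on_fiber {S : Set (Coord n × Coord n)} (hS : IsOpen S)
    {p : Coord n × Coord n} (hp : p ∈ S) {f g : Coord n × Coord n → ℝ}
    (hf : DifferentiableAt ℝ f p) (hg : DifferentiableAt ℝ g p)
    (h : ∀ q ∈ S, q.1 = p.1 → f q = g q) (i : Fin n) : pdy i f p = pdy i g p := by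
  set v : Coord n × Coord n := (0, EuclideanSpace.single i 1) with hv
  have key : ∀ {u : Coord n × Coord n → ℝ}, DifferentiableAt ℝ u p →
      HasDerivAt (fun t : ℝ => u (p + t • v)) (fderiv ℝ u p v) 0 := fun hu =>
    hu.hasFDerivAt.hasLineDerivAt v
  have hc : Continuous fun t : ℝ => p + t • v := by fun_prop
  have hmem : ∀ᶠ t : ℝ in nhds 0, p + t • v ∈ S :=
    hc.continuousAt.eventually_mem (hS.mem_nhds (by simpa using hp))
  have heq : (fun t : ℝ => f (p + t • v)) =ᶠ[nhds 0] fun t : ℝ => g (p + t • v) := by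
    filter_upwards [hmem] with t ht
    exact h _ ht (by simp [hv])
  exact (key hf).unique ((key hg).congr_of_eventuallyEq heq)

theorem hasFDerivAt_snd_apply (r : Fin n) (p : Coord n × Coord n) :
    HasFDerivAt (fun q : Coord n × Coord n => q.2 r) (dy r) p :=
  (dy r).hasFDerivAt

theorem pdy_sum_snd_mul {f : Fin n → Coord n × Coord n → ℝ} {p : Coord n × Coord n}
    (hf : ∀ r, DifferentiableAt ℝ (f r) p) (i : Fin n) :
    pdy i (fun q => ∑ r, q.2 r * f r q) p = f i p + ∑ r, p.2 r * pdy i (f r) p := by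
  have h : HasFDerivAt (fun q : Coord n × Coord n => ∑ r, q.2 r * f r q)
      (∑ r, (p.2 r • fderiv ℝ (f r) p + f r p • dy r)) p :=
    HasFDerivAt.fun_sum fun r _ => (hasFDerivAt_snd_apply r p).mul (hf r).hasFDerivAt
  unfold pdy
  rw [h.fderiv]
  simp [dy, Finset.sum_add_distrib, add_comm]

theorem pdy_sum_const_mul {f : Fin n → Coord n × Coord n → ℝ} {p : Coord n × Coord n}
    (hf : ∀ r, DifferentiableAt ℝ (f r) p) (a : Fin n → ℝ) (i : Fin n) :
    pdy i (fun q => ∑ r, a r * f r q) p = ∑ r, a r * pdy i (f r) p := by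
  have h : HasFDerivAt (fun q : Coord n × Coord n => ∑ r, a r * f r q)
      (∑ r, a r • fderiv ℝ (f r) p) p :=
    HasFDerivAt.fun_sum fun r _ => (hf r).hasFDerivAt.const_mul (a r)
  unfold pdy
  rw [h.fderiv]
  simp

theorem fderiv_fderiv_apply_comm {f : Coord n × Coord n → ℝ} {p : Coord n × Coord n}
    (hf : ContDiffAt ℝ ∞ f p) (v w : Coord n × Coord n) :
    fderiv ℝ (fun q => fderiv ℝ f q v) p w = fderiv ℝ (fun q => fderiv ℝ f q w) p v := by
  have hd : DifferentiableAt ℝ (fderiv ℝ f) p :=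
    (hf.fderiv_right (m := 1) (WithTop.coe_le_coe.2 le_top)).differentiableAt (by simp)
  have h2 : IsSymmSndFDerivAt ℝ f p := hf.isSymmSndFDerivAt (by simpa using WithTop.coe_le_coe.2 (le_top (a := (2 : ℕ∞))))
  have key : ∀ u, HasFDerivAt (fun q => fderiv ℝ f q u)
      ((ContinuousLinearMap.apply ℝ ℝ u).comp (fderiv ℝ (fderiv ℝ f) p)) p := fun u =>
    (ContinuousLinearMap.apply ℝ ℝ u).hasFDerivAt.comp p hd.hasFDerivAt
  rw [(key v).fderiv, (key w).fderiv]
  exact h2 w v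

theorem contDiffOn_fderiv_apply {S : Set (Coord n × Coord n)} (hS : IsOpen S)
    {f : Coord n × Coord n → ℝ} (hf : ContDiffOn ℝ ∞ f S) (v : Coord n × Coord n) :
    ContDiffOn ℝ ∞ (fun q => fderiv ℝ f q v) S :=
  (hf.fderiv_of_isOpen hS (by simp)).clm_apply contDiffOn_const

variable {S : Set (Coord n × Coord n)} {f : Coord n × Coord n → ℝ}

theorem contDiffOn_pdx (hS : IsOpen S) (hf : ContDiffOn ℝ ∞ f S) (k : Fin n) :
    ContDiffOn ℝ ∞ (pdx k f) S :=
  contDiffOn_fderiv_apply hS hf _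

theorem contDiffOn_pdy (hS : IsOpen S) (hf : ContDiffOn ℝ ∞ f S) (k : Fin n) :
    ContDiffOn ℝ ∞ (pdy k f) S :=
  contDiffOn_fderiv_apply hS hf _

theorem differentiableAt_of_smoothOn (hS : IsOpen S) (hf : ContDiffOn ℝ ∞ f S)
    {p : Coord n × Coord n} (hp : p ∈ S) : DifferentiableAt ℝ f p :=
  (hf.contDiffAt (hS.mem_nhds hp)).differentiableAt (by simp)

theorem pdy_comm (hS : IsOpen S) (hf : ContDiffOn ℝ ∞ f S) {p : Coord n × Coord n} (hp : p ∈ S)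
    (i j : Fin n) : pdy i (pdy j f) p = pdy j (pdy i f) p :=
  fderiv_fderiv_apply_comm (hf.contDiffAt (hS.mem_nhds hp)) _ _

theorem pdx_pdy_comm (hS : IsOpen S) (hf : ContDiffOn ℝ ∞ f S) {p : Coord n × Coord n}
    (hp : p ∈ S) (i j : Fin n) : pdx i (pdy j f) p = pdy j (pdx i f) p :=
  fderiv_fderiv_apply_comm (hf.contDiffAt (hS.mem_nhds hp)) _ _

theorem pdy_congr (hS : IsOpen S) {g : Coord n × Coord n → ℝ} (h : EqOn f g S)
    {p : Coord n × Coord n} (hp : p ∈ S) (i : Fin n) : pdy i f p = pdy i g p := by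
  unfold pdy
  rw [(h.eventuallyEq_of_mem (hS.mem_nhds hp)).fderiv_eq]

theorem single_sum_eq (y : Coord n) :
    y = ∑ k, y k • (EuclideanSpace.single k 1 : Coord n) := by
  ext i
  simp [Pi.single_apply]

theorem fderiv_snd_eq_sum_pdy (p : Coord n × Coord n) (y : Coord n) :
    fderiv ℝ f p (0, y) = ∑ k, y k * pdy k f p := by
  have h : ((0, y) : Coord n × Coord n) =
      ∑ k, y k • ((0, EuclideanSpace.single k 1) : Coord n × Coord n) := by
    refine Prod.ext ?_ ?_
    · simp [Prod.fst_sum]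
    · rw [Prod.snd_sum]
      exact single_sum_eq y
  rw [h, map_sum]
  simp only [map_smul, pdy, smul_eq_mul]

end Calculus

/-! ### Euler identities and vertical derivatives of the horizontal identity. -/

section Homogeneous

variable {n : ℕ} {S : Set (Coord n × Coord n)} {E : Coord n × Coord n → ℝ}

/-- Euler's theorem for functions homogeneous of degree two in `y`. -/
theorem euler_two (hS : IsOpen S) (hE : ContDiffOn ℝ ∞ E S)
    (hom : ∀ q ∈ S, ∀ r : ℝ, 0 < r → E (q.1, r • q.2) = r ^ 2 * E q)
    {p : Coord n × Coord n} (hp : p ∈ S) : ∑ k, p.2 k * pdy k E p = 2 * E p := by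
  rw [← fderiv_snd_eq_sum_pdy]
  have hcurve : HasDerivAt (fun r : ℝ => (p.1, r • p.2)) ((0, p.2) : Coord n × Coord n) 1 := by
    simpa using (hasDerivAt_const (1 : ℝ) p.1).prodMk ((hasDerivAt_id (1 : ℝ)).smul_const p.2)
  have hd : HasFDerivAt E (fderiv ℝ E p) ((fun r : ℝ => (p.1, r • p.2)) 1) := by
    simpa using (differentiableAt_of_smoothOn hS hE hp).hasFDerivAt
  have h1 := hd.comp_hasDerivAt (1 : ℝ) hcurve
  have h2 : HasDerivAt (fun r : ℝ => r ^ 2 * E p) (2 * E p) 1 := by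
    simpa using (hasDerivAt_pow 2 (1 : ℝ)).mul_const (E p)
  refine h1.unique (h2.congr_of_eventuallyEq ?_)
  filter_upwards [lt_mem_nhds (zero_lt_one (α := ℝ))] with r hr
  exact hom p hp r hr

theorem euler_two_pdy (hS : IsOpen S) (hE : ContDiffOn ℝ ∞ E S)
    (hom : ∀ q ∈ S, ∀ r : ℝ, 0 < r → E (q.1, r • q.2) = r ^ 2 * E q)
    {p : Coord n × Coord n} (hp : p ∈ S) (i : Fin n) :
    ∑ k, p.2 k * pdy i (pdy k E) p = pdy i E p := by
  have h := pdy_congr hS (fun q hq => euler_two hS hE hom hq) hp i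
  rw [pdy_sum_snd_mul fun r => differentiableAt_of_smoothOn hS (contDiffOn_pdy hS hE r) hp] at h
  have h2 : pdy i (fun q => 2 * E q) p = 2 * pdy i E p := by
    unfold pdy
    rw [fderiv_const_mul (differentiableAt_of_smoothOn hS hE hp)]
    simp
  linarith

/-- Differentiating Euler's relation twice in y cancels the lower-order terms. For E = L² this says
that the Cartan tensor vanishes when contracted with y. -/
theorem euler_two_pdy_pdy (hS : IsOpen S) (hE : ContDiffOn ℝ ∞ E S)
    (hom : ∀ q ∈ S, ∀ r : ℝ, 0 < r → E (q.1, r • q.2) = r ^ 2 * E q)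
    {p : Coord n × Coord n} (hp : p ∈ S) (i j : Fin n) :
    ∑ k, p.2 k * pdy j (pdy i (pdy k E)) p = 0 := by
  have h := pdy_congr hS (fun q hq => euler_two_pdy hS hE hom hq i) hp j
  rw [pdy_sum_snd_mul fun r => differentiableAt_of_smoothOn hS
    (contDiffOn_pdy hS (contDiffOn_pdy hS hE r) i) hp, pdy_comm hS hE hp] at h
  linarith

/-- Second vertical derivatives of the identity `∂E/∂x^k = Γ^l_rk y^r ∂E/∂y^l`. -/
theorem pdx_pdy_pdy_of_horizontal (hS : IsOpen S) (hE : ContDiffOn ℝ ∞ E S)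
    {p : Coord n × Coord n} (hp : p ∈ S) (Γ : Fin n → Fin n → Fin n → ℝ)
    (hor : ∀ q ∈ S, q.1 = p.1 → ∀ k,
      pdx k E q = ∑ r, q.2 r * ∑ l, Γ l r k * pdy l E q) (i j k : Fin n) :
    pdx k (pdy i (pdy j E)) p = ∑ l, Γ l i k * pdy l (pdy j E) p
      + ∑ l, Γ l j k * pdy l (pdy i E) p
      + ∑ l, (∑ r, Γ l r k * p.2 r) * pdy l (pdy i (pdy j E)) p := by
  have hy := fun l => contDiffOn_pdy hS hE l
  have hyy := fun i l => contDiffOn_pdy hS (hy l) i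
  have hsum : ∀ (a : Fin n → ℝ) (f : Fin n → Coord n × Coord n → ℝ),
      (∀ l, ContDiffOn ℝ ∞ (f l) S) → ContDiffOn ℝ ∞ (fun q => ∑ l, a l * f l q) S :=
    fun a f hf => ContDiffOn.sum fun l _ => contDiffOn_const.mul (hf l)
  have hsnd : ∀ r, ContDiffOn ℝ ∞ (fun q : Coord n × Coord n => q.2 r) S := fun r =>
    (dy r).contDiff.contDiffOn
  have hsum' : ∀ (f : Fin n → Coord n × Coord n → ℝ),
      (∀ l, ContDiffOn ℝ ∞ (f l) S) → ContDiffOn ℝ ∞ (fun q => ∑ r, q.2 r * f r q) S :=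
    fun f hf => ContDiffOn.sum fun l _ => (hsnd l).mul (hf l)
  -- The first vertical derivative is computed on the whole fibre, not just at `p`, so that it can
  -- be differentiated vertically once more.
  have first : ∀ q ∈ S, q.1 = p.1 → pdy j (pdx k E) q =
      ∑ l, Γ l j k * pdy l E q + ∑ r, q.2 r * ∑ l, Γ l r k * pdy j (pdy l E) q := by
    intro q hq hqp
    rw [pdy_congr_of_eq_on_fiber hS hq
      (differentiableAt_of_smoothOn hS (contDiffOn_pdx hS hE k) hq)
      (differentiableAt_of_smoothOn hS (hsum' _ fun r => hsum (fun l => Γ l r k) _ hy) hq)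
      (fun q' hq' h => hor q' hq' (h.trans hqp) k) j,
      pdy_sum_snd_mul fun r => differentiableAt_of_smoothOn hS (hsum _ _ hy) hq]
    congr 1
    refine Finset.sum_congr rfl fun r _ => ?_
    rw [pdy_sum_const_mul fun l => differentiableAt_of_smoothOn hS (hy l) hq]
  rw [pdx_pdy_comm hS (hy j) hp, pdy_congr hS (fun q hq => pdx_pdy_comm hS hE hq k j) hp]
  have e1 := differentiableAt_of_smoothOn hS (hsum (fun l => Γ l j k) _ hy) hp
  have e2 := differentiableAt_of_smoothOn hS
      (hsum' _ fun r => hsum (fun l => Γ l r k) _ (hyy j)) hp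
  rw [pdy_congr_of_eq_on_fiber hS hp
      (differentiableAt_of_smoothOn hS (contDiffOn_pdy hS (contDiffOn_pdx hS hE k) j) hp)
      (e1.add e2) first i]
  have hadd : pdy i ((fun q => ∑ l, Γ l j k * pdy l E q)
      + fun q => ∑ r, q.2 r * ∑ l, Γ l r k * pdy j (pdy l E) q) p =
      pdy i (fun q => ∑ l, Γ l j k * pdy l E q) p
      + pdy i (fun q => ∑ r, q.2 r * ∑ l, Γ l r k * pdy j (pdy l E) q) p := by
    unfold pdy at *
    rw [fderiv_add e1 e2]
    rfl
  rw [hadd, pdy_sum_const_mul fun l => differentiableAt_of_smoothOn hS (hy l) hp,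
    pdy_sum_snd_mul fun r => differentiableAt_of_smoothOn hS (hsum _ _ (hyy j)) hp]
  have hin : ∀ r, pdy i (fun q => ∑ l, Γ l r k * pdy j (pdy l E) q) p
      = ∑ l, Γ l r k * pdy l (pdy i (pdy j E)) p := fun r => by
    rw [pdy_sum_const_mul fun l => differentiableAt_of_smoothOn hS (hyy j l) hp]
    refine Finset.sum_congr rfl fun l _ => ?_
    rw [pdy_congr hS (fun q hq => pdy_comm hS hE hq j l) hp, pdy_comm hS (hy j) hp]
  have hlast : ∑ r, p.2 r * ∑ l, Γ l r k * pdy l (pdy i (pdy j E)) p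
      = ∑ l, (∑ r, Γ l r k * p.2 r) * pdy l (pdy i (pdy j E)) p := by
    simp only [Finset.mul_sum, Finset.sum_mul]
    rw [Finset.sum_comm]
    refine Finset.sum_congr rfl fun l _ => Finset.sum_congr rfl fun r _ => ?_
    ring
  simp only [hin, hlast]
  have c1 : ∀ l, pdy i (pdy l E) p = pdy l (pdy i E) p := fun l => pdy_comm hS hE hp i l
  have c2 : ∀ l, pdy j (pdy l E) p = pdy l (pdy j E) p := fun l => pdy_comm hS hE hp j l
  simp only [c1, c2]
  ring

end Homogeneous

/-! ### Linear algebra of the formal Christoffel symbols. -/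

section Contraction

variable {n : ℕ}

/-- Contractions of the formal Christoffel symbols when the `x`-derivatives `D` of `g` are those of
a metric compatible with a symmetric connection `Γ` that preserves the Finsler function. -/
theorem contraction_formalChristoffel {g gi : Matrix (Fin n) (Fin n) ℝ} (hgi : gi * g = 1)
    (hg : ∀ i j, g i j = g j i) {Γ C D : Fin n → Fin n → Fin n → ℝ} {y : Fin n → ℝ}
    (hΓ : ∀ i j k, Γ i j k = Γ i k j)
    (hCy : ∀ i j, ∑ k, y k * C i k j = 0)
    (hD : ∀ i j k, D i j k = ∑ l, Γ l i k * g l j + ∑ l, Γ l j k * g l i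
      + ∑ l, (∑ r, Γ l r k * y r) * C i j l) (i j : Fin n) :
    ∑ k, ((1 / 2) * ∑ s, gi i s * (D s j k - D j k s + D s k j)) * y k
      = (∑ r, Γ i r j * y r)
        + (1 / 2) * ∑ s, gi i s * ∑ l, C s j l * ∑ k, (∑ r, Γ l r k * y r) * y k := by
  have h1 : ∀ s, ∑ k, (D s j k - D j k s + D s k j) * y k
      = 2 * (∑ l, g s l * ∑ r, Γ l r j * y r)
        + ∑ l, C s j l * ∑ k, (∑ r, Γ l r k * y r) * y k := by
    intro s
    -- Two of the three `C`-terms carry the summed index k inside `C`, so contraction with y kills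
    -- them; only the term with `C s j l` survives.
    have hz : ∀ a b : Fin n, ∑ k, (∑ l, (∑ r, Γ l r a * y r) * C b k l) * y k = 0 := by
      intro a b
      simp only [Finset.sum_mul (s := Finset.univ) (f := fun l => (∑ r, Γ l r a * y r) * C b _ l)]
      rw [Finset.sum_comm]
      refine Finset.sum_eq_zero fun l _ => ?_
      rw [← mul_zero (∑ r, Γ l r a * y r), ← hCy b l, Finset.mul_sum]
      exact Finset.sum_congr rfl fun k _ => by ring
    have hQ : ∑ k, (∑ l, (∑ r, Γ l r k * y r) * C s j l) * y k
        = ∑ l, C s j l * ∑ k, (∑ r, Γ l r k * y r) * y k := by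
      simp only [Finset.sum_mul (s := Finset.univ) (f := fun l => (∑ r, Γ l r _ * y r) * C s j l)]
      rw [Finset.sum_comm]
      refine Finset.sum_congr rfl fun l _ => ?_
      rw [Finset.mul_sum]
      exact Finset.sum_congr rfl fun k _ => by ring
    have hP : ∑ k, (∑ l, Γ l j k * g l s) * y k = ∑ l, g s l * ∑ r, Γ l r j * y r := by
      simp only [Finset.sum_mul (s := Finset.univ) (f := fun l => Γ l j _ * g l s)]
      rw [Finset.sum_comm]
      refine Finset.sum_congr rfl fun l _ => ?_
      rw [Finset.mul_sum]
      refine Finset.sum_congr rfl fun k _ => ?_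
      rw [hΓ l j k, hg l s]
      ring
    have hsplit : ∀ k, (D s j k - D j k s + D s k j) * y k
        = 2 * ((∑ l, Γ l j k * g l s) * y k)
          + (∑ l, (∑ r, Γ l r k * y r) * C s j l) * y k
          - (∑ l, (∑ r, Γ l r s * y r) * C j k l) * y k
          + (∑ l, (∑ r, Γ l r j * y r) * C s k l) * y k := by
      intro k
      have s1 : ∀ a b c : Fin n, ∑ l, Γ l a b * g l c = ∑ l, Γ l b a * g l c := fun a b c =>
        Finset.sum_congr rfl fun l _ => by rw [hΓ]
      rw [hD, hD, hD, s1 j s k, s1 s k j, s1 s j k, s1 k s j, s1 k j s]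
      ring
    simp only [hsplit, Finset.sum_add_distrib, Finset.sum_sub_distrib, hz, ← Finset.mul_sum, hQ, hP]
    ring
  have h2 : ∑ k, ((1 / 2) * ∑ s, gi i s * (D s j k - D j k s + D s k j)) * y k
      = (1 / 2) * ∑ s, gi i s * ∑ k, (D s j k - D j k s + D s k j) * y k := by
    simp only [Finset.mul_sum, Finset.sum_mul]
    rw [Finset.sum_comm]
    exact Finset.sum_congr rfl fun s _ => Finset.sum_congr rfl fun k _ => by ring
  have h3 : ∑ s, gi i s * ∑ l, g s l * ∑ r, Γ l r j * y r = ∑ r, Γ i r j * y r := by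
    have : ∀ l, ∑ s, gi i s * g s l = if i = l then 1 else 0 := fun l => by
      rw [← Matrix.mul_apply, hgi, Matrix.one_apply]
    simp only [Finset.mul_sum (s := Finset.univ) (f := fun l => g _ l * _)]
    rw [Finset.sum_comm]
    simp only [← mul_assoc, ← Finset.sum_mul, this]
    simp
  rw [h2]
  simp only [h1, mul_add, Finset.sum_add_distrib]
  rw [← h3]
  congr 1
  rw [Finset.mul_sum]
  exact Finset.sum_congr rfl fun s _ => by ring

end Contraction

/-! ### The structure equations in one chart. -/

section LocalChern

variable {n : ℕ} {S : Set (Coord n × Coord n)} {L : Coord n × Coord n → ℝ}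
  {p : Coord n × Coord n}

theorem dx_apply (k : Fin n) (v : Coord n × Coord n) : dx k v = v.1 k := rfl

theorem dy_apply (k : Fin n) (v : Coord n × Coord n) : dy k v = v.2 k := rfl

theorem dx_single (k m : Fin n) (y : Coord n) :
    dx k (EuclideanSpace.single m 1, y) = if k = m then 1 else 0 := by
  simp [dx_apply]

theorem dy_single (k m : Fin n) (x : Coord n) :
    dy k (x, EuclideanSpace.single m 1) = if k = m then 1 else 0 := by
  simp [dy_apply]

theorem fundamentalMatrix_apply (L : Coord n × Coord n → ℝ) (p : Coord n × Coord n)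
    (i j : Fin n) :
    fundamentalMatrix L p i j = (1 / 2) * pdy i (pdy j fun q => L q ^ 2) p := rfl

theorem fderiv_fundamentalMatrix_apply (hS : IsOpen S) (hL : ContDiffOn ℝ ∞ L S) (hp : p ∈ S)
    (i j : Fin n) (v : Coord n × Coord n) :
    fderiv ℝ (fun q => fundamentalMatrix L q i j) p v =
      (1 / 2) * fderiv ℝ (pdy i (pdy j fun q => L q ^ 2)) p v := by
  have h := (differentiableAt_of_smoothOn hS
    (contDiffOn_pdy hS (contDiffOn_pdy hS (hL.pow 2) j) i) hp).hasFDerivAt.const_mul (1 / 2 : ℝ)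
  have h' : HasFDerivAt (fun q => fundamentalMatrix L q i j) _ p := h
  rw [h'.fderiv]
  simp

theorem fundamentalMatrix_symm (hS : IsOpen S) (hL : ContDiffOn ℝ ∞ L S) (hp : p ∈ S)
    (i j : Fin n) : fundamentalMatrix L p i j = fundamentalMatrix L p j i := by
  rw [fundamentalMatrix_apply, fundamentalMatrix_apply, pdy_comm hS (hL.pow 2) hp]

theorem clm_ext_of_basis {α β : Coord n × Coord n →L[ℝ] ℝ}
    (hx : ∀ k, α (EuclideanSpace.single k 1, 0) = β (EuclideanSpace.single k 1, 0))
    (hy : ∀ k, α (0, EuclideanSpace.single k 1) = β (0, EuclideanSpace.single k 1)) : α = β := by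
  refine ContinuousLinearMap.ext fun v => ?_
  have h : v = ∑ k, v.1 k • ((EuclideanSpace.single k 1, 0) : Coord n × Coord n)
      + ∑ k, v.2 k • ((0, EuclideanSpace.single k 1) : Coord n × Coord n) := by
    refine Prod.ext ?_ ?_
    · rw [Prod.fst_add, Prod.fst_sum, Prod.fst_sum]
      simpa using single_sum_eq v.1
    · rw [Prod.snd_add, Prod.snd_sum, Prod.snd_sum]
      simpa using single_sum_eq v.2
  rw [h]
  simp only [map_add, map_sum, map_smul, hx, hy]

/-- Euler's identities give g_ij y^i y^j = L², and y is nonzero. -/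
theorem pos_of_posDef (hS : IsOpen S) (hL : ContDiffOn ℝ ∞ L S) (hp : p ∈ S) (hp0 : p.2 ≠ 0)
    (hom : ∀ q ∈ S, ∀ r : ℝ, 0 < r → L (q.1, r • q.2) = r * L q)
    (hg : (fundamentalMatrix L p).PosDef) : 0 < L p ^ 2 := by
  have hE : ContDiffOn ℝ ∞ (fun q => L q ^ 2) S := hL.pow 2
  have homE : ∀ q ∈ S, ∀ r : ℝ, 0 < r →
      (fun q => L q ^ 2) (q.1, r • q.2) = r ^ 2 * (fun q => L q ^ 2) q := fun q hq r hr => by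
    simp only [hom q hq r hr]; ring
  have h := hg.dotProduct_mulVec_pos (x := fun i => p.2 i)
    (fun h0 => hp0 (by ext i; exact congrFun h0 i))
  have e : star (fun i => p.2 i) ⬝ᵥ (fundamentalMatrix L p).mulVec (fun i => p.2 i)
      = L p ^ 2 := by
    have e1 : ∀ i, (fundamentalMatrix L p).mulVec (fun i => p.2 i) i
        = (1 / 2) * pdy i (fun q => L q ^ 2) p := fun i => by
      rw [← euler_two_pdy hS hE homE hp i, Finset.mul_sum]
      simp only [Matrix.mulVec, dotProduct, fundamentalMatrix_apply]
      exact Finset.sum_congr rfl fun k _ => by ring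
    have e2 := euler_two hS hE homE hp
    simp only [dotProduct, e1, star_trivial]
    have : ∑ i, p.2 i * (1 / 2 * pdy i (fun q => L q ^ 2) p)
        = 1 / 2 * ∑ i, p.2 i * pdy i (fun q => L q ^ 2) p := by
      rw [Finset.mul_sum]
      exact Finset.sum_congr rfl fun k _ => by ring
    rw [this, e2]
    ring
  rwa [e] at h

variable {Γ : Fin n → Fin n → Fin n → ℝ}

/-- If the horizontal distribution of a linear connection annihilates `L²`, the `x`-derivatives of
the fundamental tensor are determined by `Γ` and the `y`-derivatives. -/
theorem pdx_fundamentalMatrix (hS : IsOpen S) (hL : ContDiffOn ℝ ∞ L S) (hp : p ∈ S)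
    (hor : ∀ q ∈ S, q.1 = p.1 → ∀ k, pdx k (fun q => L q ^ 2) q
      = ∑ r, q.2 r * ∑ l, Γ l r k * pdy l (fun q => L q ^ 2) q) (i j k : Fin n) :
    pdx k (fun q => fundamentalMatrix L q i j) p =
      ∑ l, Γ l i k * fundamentalMatrix L p l j + ∑ l, Γ l j k * fundamentalMatrix L p l i
      + ∑ l, (∑ r, Γ l r k * p.2 r) * pdy l (fun q => fundamentalMatrix L q i j) p := by
  have hE : ContDiffOn ℝ ∞ (fun q => L q ^ 2) S := hL.pow 2
  have e1 : pdx k (fun q => fundamentalMatrix L q i j) p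
      = (1 / 2) * pdx k (pdy i (pdy j fun q => L q ^ 2)) p :=
    fderiv_fundamentalMatrix_apply hS hL hp i j _
  have e2 : ∀ l, pdy l (fun q => fundamentalMatrix L q i j) p
      = (1 / 2) * pdy l (pdy i (pdy j fun q => L q ^ 2)) p := fun l =>
    fderiv_fundamentalMatrix_apply hS hL hp i j _
  rw [e1, pdx_pdy_pdy_of_horizontal hS hE hp Γ hor i j k]
  simp only [e2]
  simp only [fundamentalMatrix_apply, mul_add, Finset.mul_sum]
  congr 1
  · congr 1 <;> exact Finset.sum_congr rfl fun l _ => by ring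
  · exact Finset.sum_congr rfl fun l _ => by ring

/-- Put G^l = Γ^l_rk y^r y^k. Contracting γ once with y gives Γ^i_rj y^r plus the error (1/2) g^is
(∂g_sj/∂y^l) G^l. A second contraction kills the error, so γ^k_rs y^r y^s = G^k, and the Cartan term
in the definition of N subtracts exactly that error. -/
theorem nonlinearConnection_eq (hS : IsOpen S) (hL : ContDiffOn ℝ ∞ L S) (hp : p ∈ S)
    (hL0 : L p ≠ 0)
    (hom : ∀ q ∈ S, ∀ r : ℝ, 0 < r → L (q.1, r • q.2) = r * L q)
    (hg : (fundamentalMatrix L p).PosDef) (hΓ : ∀ i j k, Γ i j k = Γ i k j)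
    (hor : ∀ q ∈ S, q.1 = p.1 → ∀ k, pdx k (fun q => L q ^ 2) q
      = ∑ r, q.2 r * ∑ l, Γ l r k * pdy l (fun q => L q ^ 2) q) (i j : Fin n) :
    nonlinearConnection L p i j = ∑ r, Γ i r j * p.2 r := by
  have hE : ContDiffOn ℝ ∞ (fun q => L q ^ 2) S := hL.pow 2
  have homE : ∀ q ∈ S, ∀ r : ℝ, 0 < r →
      (fun q => L q ^ 2) (q.1, r • q.2) = r ^ 2 * (fun q => L q ^ 2) q := fun q hq r hr => by
    simp only [hom q hq r hr]; ring
  set C : Fin n → Fin n → Fin n → ℝ :=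
    fun i j k => pdy k (fun q => fundamentalMatrix L q i j) p with hCdef
  have hC : ∀ i j k, C i j k = (1 / 2) * pdy k (pdy i (pdy j fun q => L q ^ 2)) p := fun i j k =>
    fderiv_fundamentalMatrix_apply hS hL hp i j _
  have hCy : ∀ i j, ∑ k, p.2 k * C i k j = 0 := fun i j => by
    have h := euler_two_pdy_pdy hS hE homE hp i j
    have e : ∑ k, p.2 k * C i k j
        = (1 / 2) * ∑ k, p.2 k * pdy j (pdy i (pdy k fun q => L q ^ 2)) p := by
      rw [Finset.mul_sum]
      exact Finset.sum_congr rfl fun k _ => by rw [hC]; ring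
    rw [e, h, mul_zero]
  have hgi : (fundamentalMatrix L p)⁻¹ * fundamentalMatrix L p = 1 :=
    Matrix.nonsing_inv_mul _ ((Matrix.isUnit_iff_isUnit_det _).1 hg.isUnit)
  have hD := pdx_fundamentalMatrix hS hL hp hor
  have hcon : ∀ i j, ∑ k, formalChristoffel L p i j k * p.2 k = _ := fun i j =>
    contraction_formalChristoffel hgi (fundamentalMatrix_symm hS hL hp) hΓ hCy hD i j
  have hcon2 : ∀ k, ∑ r, ∑ s, formalChristoffel L p k r s * p.2 r * p.2 s
      = ∑ s, (∑ r, Γ k r s * p.2 r) * p.2 s := fun k => by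
    have e : ∀ r, ∑ s, formalChristoffel L p k r s * p.2 r * p.2 s
        = (∑ s, formalChristoffel L p k r s * p.2 s) * p.2 r := fun r => by
      rw [Finset.sum_mul]
      exact Finset.sum_congr rfl fun s _ => by ring
    simp only [e, hcon, add_mul, Finset.sum_add_distrib]
    rw [add_eq_left]
    -- The repeated exchanges move the sum over r innermost, where it is a contraction of `C` with
    -- y.
    simp only [Finset.mul_sum, Finset.sum_mul]
    rw [Finset.sum_comm]
    refine Finset.sum_eq_zero fun s _ => ?_
    rw [Finset.sum_comm]
    refine Finset.sum_eq_zero fun l _ => ?_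
    rw [Finset.sum_comm]
    refine Finset.sum_eq_zero fun a _ => ?_
    rw [Finset.sum_comm]
    refine Finset.sum_eq_zero fun b _ => ?_
    have := hCy s l
    calc _ = (1 / 2 * ((fundamentalMatrix L p)⁻¹ k s * (Γ l b a * p.2 b * p.2 a)))
          * ∑ x, p.2 x * C s x l := by
          rw [Finset.mul_sum]
          exact Finset.sum_congr rfl fun x _ => by ring
      _ = 0 := by rw [this, mul_zero]
  have hterm : ∀ k, ∑ r, ∑ s, cartanUp L p i j k * formalChristoffel L p k r s * (p.2 r / L p)
      * (p.2 s / L p) = (L p)⁻¹ ^ 2 * cartanUp L p i j k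
        * ∑ s, (∑ r, Γ k r s * p.2 r) * p.2 s := fun k => by
    rw [← hcon2 k]
    simp only [Finset.mul_sum]
    exact Finset.sum_congr rfl fun r _ => Finset.sum_congr rfl fun s _ => by
      rw [div_eq_mul_inv, div_eq_mul_inv]; ring
  have hfirst : ∑ k, formalChristoffel L p i j k * (p.2 k / L p)
      = (L p)⁻¹ * ∑ k, formalChristoffel L p i j k * p.2 k := by
    rw [Finset.mul_sum]
    exact Finset.sum_congr rfl fun k _ => by rw [div_eq_mul_inv]; ring
  have hA : ∑ k, (L p)⁻¹ ^ 2 * cartanUp L p i j k * ∑ s, (∑ r, Γ k r s * p.2 r) * p.2 s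
      = (L p)⁻¹ * ((1 / 2) * ∑ s, (fundamentalMatrix L p)⁻¹ i s *
          ∑ l, C s j l * ∑ k, (∑ r, Γ l r k * p.2 r) * p.2 k) := by
    have e : ∀ k, cartanUp L p i j k
        = L p * ((1 / 2) * ∑ s, (fundamentalMatrix L p)⁻¹ i s * C s j k) := fun k => by
      simp only [cartanUp, cartan, hCdef, Finset.mul_sum]
      exact Finset.sum_congr rfl fun s _ => by ring
    simp only [e]
    -- G^l is made opaque so that distributing the products does not expand it.
    generalize hz : (fun l => ∑ k, (∑ r, Γ l r k * p.2 r) * p.2 k) = z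
    have hz' : ∀ l, ∑ k, (∑ r, Γ l r k * p.2 r) * p.2 k = z l := fun l => congrFun hz l
    simp only [hz']
    simp only [Finset.mul_sum, Finset.sum_mul]
    rw [Finset.sum_comm]
    refine Finset.sum_congr rfl fun s _ => Finset.sum_congr rfl fun k _ => ?_
    field_simp
  unfold nonlinearConnection
  simp only [hterm]
  rw [hA, hfirst, hcon i j]
  field_simp
  ring

/-- A symmetric linear connection on the base whose horizontal distribution annihilates `L²`
satisfies the almost metric compatibility equation of the Chern connection. -/
theorem almost_compatible_of_horizontal (hS : IsOpen S) (hL : ContDiffOn ℝ ∞ L S) (hp : p ∈ S)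
    (hL0 : L p ≠ 0)
    (hom : ∀ q ∈ S, ∀ r : ℝ, 0 < r → L (q.1, r • q.2) = r * L q)
    (hg : (fundamentalMatrix L p).PosDef) (hΓ : ∀ i j k, Γ i j k = Γ i k j)
    (hor : ∀ q ∈ S, q.1 = p.1 → ∀ k, pdx k (fun q => L q ^ 2) q
      = ∑ r, q.2 r * ∑ l, Γ l r k * pdy l (fun q => L q ^ 2) q) (i j : Fin n) :
    fderiv ℝ (fun q => fundamentalMatrix L q i j) p
        - ∑ k, fundamentalMatrix L p k j • ∑ m, Γ k i m • dx m
        - ∑ k, fundamentalMatrix L p i k • ∑ m, Γ k j m • dx m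
      = ∑ k, (2 * cartan L p i j k) • deltaY L p k := by
  refine clm_ext_of_basis (fun m => ?_) fun m => ?_
  · have h := pdx_fundamentalMatrix hS hL hp hor i j m
    have hN := nonlinearConnection_eq hS hL hp hL0 hom hg hΓ hor
    rw [pdx] at h
    simp only [sub_apply, h, cartan, deltaY, sum_apply, smul_apply, add_apply, hN, dx_single,
      dy_apply, PiLp.zero_apply, smul_eq_mul, mul_ite, mul_one, mul_zero,
      Finset.sum_ite_eq', Finset.mem_univ, if_true, zero_add]
    have e1 : ∑ k, fundamentalMatrix L p k j * Γ k i m = ∑ l, Γ l i m * fundamentalMatrix L p l j :=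
      Finset.sum_congr rfl fun l _ => mul_comm _ _
    have e2 : ∑ k, fundamentalMatrix L p i k * Γ k j m = ∑ l, Γ l j m * fundamentalMatrix L p l i :=
      Finset.sum_congr rfl fun l _ => by rw [fundamentalMatrix_symm hS hL hp i l, mul_comm]
    rw [e1, e2]
    have e3 : ∀ k, 2 * (L p / 2 * pdy k (fun q => fundamentalMatrix L q i j) p) *
        ((L p)⁻¹ * ∑ r, Γ k r m * p.2 r)
        = (∑ r, Γ k r m * p.2 r) * pdy k (fun q => fundamentalMatrix L q i j) p := fun k => by
      field_simp
    simp only [e3]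
    ring
  · simp only [sub_apply, cartan, deltaY, sum_apply, smul_apply, add_apply, dx_apply,
      dy_single, PiLp.zero_apply, smul_eq_mul, mul_ite, mul_one, mul_zero,
      Finset.sum_ite_eq', Finset.mem_univ, if_true, add_zero, Finset.sum_const_zero, sub_zero]
    unfold pdy
    field_simp

end LocalChern

/-! ### Smoothness and nondegeneracy of `F` and `h` in natural coordinates. -/

section ManifoldSmoothness
variable {n : ℕ} {M : Type*} [TopologicalSpace M] [ChartedSpace (Coord n) M]

theorem isOpen_slitDomain {M : Type*} [TopologicalSpace M] (φ : OpenPartialHomeomorph M (Coord n)) : IsOpen (slitDomain φ) :=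
  (φ.open_target.preimage continuous_fst).inter
    (isOpen_compl_singleton.preimage continuous_snd)

theorem contMDiff_mk_tangentBundle_modelSpace :
    ContMDiff 𝓘(ℝ, Coord n × Coord n) (𝓡 n).tangent ∞
      (fun p : Coord n × Coord n => (⟨p.1, p.2⟩ : TangentBundle (𝓡 n) (Coord n))) := by
  intro p
  rw [contMDiffAt_totalSpace]
  refine ⟨contDiff_fst.contMDiff p, ?_⟩
  simp only [trivializationAt_model_space_apply]
  exact contDiff_snd.contMDiff p

variable [IsManifold (𝓡 n) ∞ M] {φ : OpenPartialHomeomorph M (Coord n)}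

/-- On this domain the map is the tangent map of the smooth inverse chart `φ.symm`. -/
theorem contMDiffOn_natPoint
    (hφ : φ ∈ IsManifold.maximalAtlas (𝓡 n) ∞ M) :
    ContMDiffOn 𝓘(ℝ, Coord n × Coord n) (𝓡 n).tangent ∞ (natPoint φ)
      (Prod.fst ⁻¹' φ.target) := by
  have hs := contMDiffOn_symm_of_mem_maximalAtlas hφ
  have : IsManifold (𝓡 n) 1 M := IsManifold.of_le (n := ∞) (by simp)
  have ht := hs.contMDiffOn_tangentMapWithin (m := ∞) (by simp) φ.open_target.uniqueMDiffOn
  have := ht.comp contMDiff_mk_tangentBundle_modelSpace.contMDiffOn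
    (s := Prod.fst ⁻¹' φ.target) (fun p hp => hp)
  refine this.congr fun p hp => ?_
  simp [natPoint, tangentMapWithin, mfderivWithin_of_isOpen φ.open_target hp]

omit [IsManifold (𝓡 n) ∞ M] in
theorem mdifferentiable_of_mem_maximalAtlas_infty
    (hφ : φ ∈ IsManifold.maximalAtlas (𝓡 n) ∞ M) :
    φ.MDifferentiable (𝓡 n) (𝓡 n) :=
  ⟨(contMDiffOn_of_mem_maximalAtlas hφ).mdifferentiableOn (by simp),
    (contMDiffOn_symm_of_mem_maximalAtlas hφ).mdifferentiableOn (by simp)⟩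

omit [IsManifold (𝓡 n) ∞ M] in
theorem natCoord_natPoint (hφ : φ ∈ IsManifold.maximalAtlas (𝓡 n) ∞ M)
    {p : Coord n × Coord n} (hx : p.1 ∈ φ.target) :
    natCoord φ (natPoint φ p) = p := by
  have h := (mdifferentiable_of_mem_maximalAtlas_infty hφ).comp_symm_deriv hx
  refine Prod.ext (φ.right_inv hx) ?_
  exact congrArg (fun A : Coord n →L[ℝ] Coord n => A p.2) h

omit [IsManifold (𝓡 n) ∞ M] in
theorem natPoint_mem_slit (hφ : φ ∈ IsManifold.maximalAtlas (𝓡 n) ∞ M)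
    {p : Coord n × Coord n} (hx : p ∈ slitDomain φ) :
    natPoint φ p ∈ slit n M := by
  intro h0
  have h := congrArg Prod.snd (natCoord_natPoint hφ hx.1)
  refine hx.2 (h.symm.trans ?_)
  show mfderiv (𝓡 n) (𝓡 n) φ (natPoint φ p).proj (natPoint φ p).snd = 0
  rw [h0]
  exact map_zero _

theorem contDiffOn_inCoord (hφ : φ ∈ IsManifold.maximalAtlas (𝓡 n) ∞ M)
    {F : TangentBundle (𝓡 n) M → ℝ}
    (hF : ContMDiffOn (𝓡 n).tangent 𝓘(ℝ, ℝ) ∞ F (slit n M)) :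
    ContDiffOn ℝ ∞ (inCoord φ F) (slitDomain φ) := by
  rw [← contMDiffOn_iff_contDiffOn]
  exact hF.comp ((contMDiffOn_natPoint hφ).mono fun p hp => hp.1)
    fun p hp => natPoint_mem_slit hφ hp

theorem contDiffOn_metricMatrix (hφ : φ ∈ IsManifold.maximalAtlas (𝓡 n) ∞ M)
    (h : Metric n M) (i j : Fin n) :
    ContDiffOn ℝ ∞ (fun x => metricMatrix h φ x i j) φ.target := by
  have hv : ∀ i : Fin n, ContMDiffOn (𝓡 n) (𝓡 n).tangent ∞ 
    (fun x : Coord n => natPoint φ (x, EuclideanSpace.single i 1)) φ.target := by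
    intro i
    refine (contMDiffOn_natPoint hφ).comp
      (f := fun x : Coord n => (x, (EuclideanSpace.single i 1 : Coord n))) ?_ fun x hx => hx
    exact ContDiff.contMDiff (by fun_prop) |>.contMDiffOn
  have hb : ContMDiffOn (𝓡 n) (𝓡 n) ∞ φ.symm φ.target := contMDiffOn_symm_of_mem_maximalAtlas hφ
  have : ContMDiffOn (𝓡 n) ((𝓡 n).prod 𝓘(ℝ)) ∞
      (fun x => TotalSpace.mk' ℝ (E := Bundle.Trivial M ℝ) (φ.symm x) 
        (h.inner (φ.symm x) (natPoint φ (x, EuclideanSpace.single i 1)).2 (natPoint φ (x, EuclideanSpace.single j 1)).2)) φ.target := by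
    apply ContMDiffOn.clm_bundle_apply₂ (F₁ := Coord n) (F₂ := Coord n)
    · exact h.contMDiff.comp_contMDiffOn hb
    · exact hv i
    · exact hv j
  rw [← contMDiffOn_iff_contDiffOn]
  intro x hx
  have hx' := this x hx
  rw [contMDiffWithinAt_totalSpace] at hx'
  exact hx'.2

/-- A kernel vector of the matrix would be the coordinates of a nonzero tangent vector of `h`-length
zero. -/
theorem det_metricMatrix_ne_zero (hφ : φ ∈ IsManifold.maximalAtlas (𝓡 n) ∞ M)
    (h : Metric n M) {x : Coord n} (hx : x ∈ φ.target) : (metricMatrix h φ x).det ≠ 0 := by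
  intro hdet
  obtain ⟨v, hv, hv0⟩ := Matrix.exists_mulVec_eq_zero_iff.2 hdet
  set A : Coord n →L[ℝ] TangentSpace (𝓡 n) (φ.symm x) := mfderiv (𝓡 n) (𝓡 n) φ.symm x
  set w : Coord n := WithLp.toLp 2 v
  have hw0 : w ≠ 0 := fun h0 => hv (funext fun i => congrFun (congrArg WithLp.ofLp h0) i)
  have hAw : A w ≠ 0 := natPoint_mem_slit hφ (p := (x, w)) ⟨hx, hw0⟩
  have hpos := h.pos (φ.symm x) (A w) hAw
  have hsum : A w = ∑ i, v i • A (EuclideanSpace.single i 1) := by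
    conv_lhs => rw [single_sum_eq w]
    rw [map_sum]
    exact Finset.sum_congr rfl fun i _ => map_smul A _ _
  have hM : ∀ i j, h.inner (φ.symm x) (A (EuclideanSpace.single i 1))
      (A (EuclideanSpace.single j 1)) = metricMatrix h φ x i j := fun _ _ => rfl
  have hz : h.inner (φ.symm x) (A w) (A w) = v ⬝ᵥ (metricMatrix h φ x).mulVec v := by
    rw [hsum]
    simp only [map_sum, map_smul, sum_apply, smul_apply, smul_eq_mul, dotProduct, Matrix.mulVec,
      Finset.mul_sum, hM]
    rw [Finset.sum_comm]
    exact Finset.sum_congr rfl fun i _ => Finset.sum_congr rfl fun j _ => by ring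
  rw [hz, hv0, dotProduct_zero] at hpos
  exact lt_irrefl _ hpos

theorem metricMatrix_symm (h : Metric n M) (φ : OpenPartialHomeomorph M (Coord n)) (x : Coord n)
    (i j : Fin n) : metricMatrix h φ x i j = metricMatrix h φ x j i :=
  h.symm _ _ _

theorem leviCivita_symm (h : Metric n M) (φ : OpenPartialHomeomorph M (Coord n)) (x : Coord n)
    (i j k : Fin n) : leviCivita h φ x i j k = leviCivita h φ x i k j := by
  have e : (fun z => metricMatrix h φ z j k) = fun z => metricMatrix h φ z k j :=
    funext fun z => metricMatrix_symm h φ z j k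
  unfold leviCivita
  rw [e]
  congr 1
  exact Finset.sum_congr rfl fun s _ => by ring

end ManifoldSmoothness

/-! ### Smoothness of the inverse matrix, by Cramer's rule. -/

section MatrixSmoothness

variable {V : Type*} [NormedAddCommGroup V] [NormedSpace ℝ V] {m : Type*} [Fintype m]
  [DecidableEq m] {A : V → Matrix m m ℝ} {s : Set V} {N : WithTop ℕ∞}

theorem contDiffOn_det (hA : ∀ i j, ContDiffOn ℝ N (fun x => A x i j) s) :
    ContDiffOn ℝ N (fun x => (A x).det) s := by
  simp only [Matrix.det_apply']
  exact ContDiffOn.sum fun σ _ => contDiffOn_const.mul (contDiffOn_prod fun i _ => hA _ _)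

theorem contDiffOn_matrix_inv (hA : ∀ i j, ContDiffOn ℝ N (fun x => A x i j) s)
    (hdet : ∀ x ∈ s, (A x).det ≠ 0) (i j : m) : ContDiffOn ℝ N (fun x => (A x)⁻¹ i j) s := by
  have hadj : ContDiffOn ℝ N (fun x => (A x).adjugate i j) s := by
    simp only [Matrix.adjugate_apply]
    refine contDiffOn_det fun a b => ?_
    by_cases h : a = j
    · subst h
      simpa only [Matrix.updateRow_self] using contDiffOn_const
    · simpa only [Matrix.updateRow_ne h] using hA a b
  simp only [Matrix.inv_def, Ring.inverse_eq_inv', Matrix.smul_apply, smul_eq_mul]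
  exact ((contDiffOn_det hA).inv hdet).mul hadj

end MatrixSmoothness

/-! ### Smoothness of the Levi-Civita coefficients. -/

section LeviCivita

variable {n : ℕ} {M : Type*} [TopologicalSpace M] [ChartedSpace (Coord n) M]
  [IsManifold (𝓡 n) ∞ M] {φ : OpenPartialHomeomorph M (Coord n)}

theorem contDiffOn_leviCivita (hφ : φ ∈ IsManifold.maximalAtlas (𝓡 n) ∞ M) (h : Metric n M)
    (i j k : Fin n) : ContDiffOn ℝ ∞ (fun x => leviCivita h φ x i j k) φ.target := by
  have hd : ∀ (a b : Fin n) (v : Coord n),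
      ContDiffOn ℝ ∞ (fun x => fderiv ℝ (fun z => metricMatrix h φ z a b) x v) φ.target :=
    fun a b v => ((contDiffOn_metricMatrix hφ h a b).fderiv_of_isOpen φ.open_target
      (by simp)).clm_apply contDiffOn_const
  exact contDiffOn_const.mul (ContDiffOn.sum fun s _ =>
    (contDiffOn_matrix_inv (contDiffOn_metricMatrix hφ h)
      (fun x hx => det_metricMatrix_ne_zero hφ h hx) i s).mul
    (((hd s j _).sub (hd j k _)).add (hd s k _)))

end LeviCivita

/-! ### From parallel transport to the horizontal identity. -/

section Transport

variable {n : ℕ} {M : Type*} [TopologicalSpace M] [ChartedSpace (Coord n) M]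
  [IsManifold (𝓡 n) ∞ M] {φ : OpenPartialHomeomorph M (Coord n)}

omit [IsManifold (𝓡 n) ∞ M] in
theorem natPoint_smul (φ : OpenPartialHomeomorph M (Coord n)) (x y : Coord n) (r : ℝ) :
    natPoint φ (x, r • y) = ⟨φ.symm x, r • (natPoint φ (x, y)).snd⟩ :=
  congrArg (TotalSpace.mk (F := Coord n) (E := TangentSpace (𝓡 n)) (φ.symm x))
    (map_smul (mfderiv (𝓡 n) (𝓡 n) φ.symm x) r y)

theorem inCoord_smul {F : TangentBundle (𝓡 n) M → ℝ} (hF : IsFinslerStructure F)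
    (φ : OpenPartialHomeomorph M (Coord n)) (x y : Coord n) {r : ℝ} (hr : 0 < r) :
    inCoord φ F (x, r • y) = r * inCoord φ F (x, y) := by
  unfold inCoord
  rw [natPoint_smul]
  exact hF.homogeneous _ _ r hr

theorem inCoord_pos {F : TangentBundle (𝓡 n) M → ℝ} (hF : IsFinslerStructure F)
    (hφ : φ ∈ IsManifold.maximalAtlas (𝓡 n) ∞ M) {p : Coord n × Coord n}
    (hp : p ∈ slitDomain φ) : 0 < inCoord φ F p :=
  lt_of_le_of_ne (hF.nonneg _) fun h0 => by
    have := pos_of_posDef (isOpen_slitDomain φ) (contDiffOn_inCoord hφ hF.smooth) hp hp.2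
      (fun q _ r hr => inCoord_smul hF φ q.1 q.2 hr) (hF.stronglyConvex φ hφ p hp)
    rw [← h0] at this
    norm_num at this

/-- The vertical component at `(x, ξ)` of the horizontal lift of `X` for the Levi-Civita connection
of `h`, in natural coordinates. -/
noncomputable def verticalLift (h : Metric n M) (φ : OpenPartialHomeomorph M (Coord n))
    (X : Coord n) (p : Coord n × Coord n) : Coord n :=
  WithLp.toLp 2 fun i => -∑ j, (∑ k, leviCivita h φ p.1 i j k * X k) * p.2 j

/-- Bilinearity in the direction and the field: parallel fields may be rescaled, and time may be
reparametrized linearly. -/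
theorem verticalLift_smul (h : Metric n M) (X : Coord n) (x y : Coord n) (a b : ℝ) :
    verticalLift h φ (a • X) (x, b • y) = b • a • verticalLift h φ X (x, y) := by
  ext i
  simp only [verticalLift, PiLp.smul_apply, smul_eq_mul, mul_neg, Finset.mul_sum, Finset.sum_mul]
  congr 1
  exact Finset.sum_congr rfl fun j _ => Finset.sum_congr rfl fun k _ => by ring

theorem contDiffOn_verticalLift (hφ : φ ∈ IsManifold.maximalAtlas (𝓡 n) ∞ M) (h : Metric n M)
    (X : Coord n) : ContDiffOn ℝ ∞ (verticalLift h φ X) (Prod.fst ⁻¹' φ.target) := by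
  rw [contDiffOn_euclidean]
  intro i
  refine (ContDiffOn.sum fun j _ => ContDiffOn.mul (ContDiffOn.sum fun k _ =>
    ContDiffOn.mul ?_ contDiffOn_const) ?_).neg
  · exact (contDiffOn_leviCivita hφ h i j k).comp contDiffOn_fst fun p hp => hp
  · exact (dy j).contDiff.contDiffOn

/-- Local existence of parallel fields along coordinate lines. -/
theorem exists_parallel_curve (hφ : φ ∈ IsManifold.maximalAtlas (𝓡 n) ∞ M) (h : Metric n M)
    (X : Coord n) {p : Coord n × Coord n} (hp : p.1 ∈ φ.target) :
    ∃ ξ : ℝ → Coord n, ξ 0 = p.2 ∧ ∃ ε > (0 : ℝ), ∀ t ∈ Ioo (-ε) ε,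
      p.1 + t • X ∈ φ.target ∧ HasDerivAt ξ (verticalLift h φ X (p.1 + t • X, ξ t)) t := by
  -- Adding the base point as an unknown with constant velocity `X` makes the equation autonomous;
  -- its base component is then the line, by `hfst`.
  have hv : ContDiffAt ℝ 1 (fun q : Coord n × Coord n => (X, verticalLift h φ X q)) p :=
    contDiffAt_const.prodMk (((contDiffOn_verticalLift hφ h X).contDiffAt
      ((φ.open_target.preimage continuous_fst).mem_nhds hp)).of_le (by simp))
  obtain ⟨α, hα0, ε, hε, hα⟩ :=
    hv.exists_forall_mem_closedBall_exists_eq_forall_mem_Ioo_hasDerivAt₀ 0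
  simp only [zero_sub, zero_add] at hα
  have hfst : ∀ t ∈ Ioo (-ε) ε, (α t).1 = p.1 + t • X := by
    have hd : ∀ t ∈ Ioo (-ε) ε, HasDerivAt (fun t => (α t).1 - t • X) 0 t := fun t ht => by
      have h1 : HasDerivAt (fun t => (α t).1) X t :=
        (hasFDerivAt_fst (𝕜 := ℝ) (p := α t)).comp_hasDerivAt t (hα t ht)
      have h2 := h1.sub ((hasDerivAt_id t).smul_const X)
      rw [one_smul, sub_self] at h2
      exact h2
    intro t ht
    have := isOpen_Ioo.is_const_of_deriv_eq_zero (isPreconnected_Ioo (a := -ε) (b := ε))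
      (fun t ht => (hd t ht).differentiableAt.differentiableWithinAt)
      (fun t ht => (hd t ht).deriv) ht (show (0 : ℝ) ∈ Ioo (-ε) ε by simp [hε])
    simp only [hα0, zero_smul, sub_zero] at this
    rw [← this]
    abel
  -- A second radius δ keeps the line inside the chart, which the existence theorem does not
  -- guarantee.
  have hc : Continuous fun t : ℝ => p.1 + t • X := by fun_prop
  obtain ⟨δ, hδ, hδt⟩ := Metric.eventually_nhds_iff_ball.1 (hc.continuousAt.eventually_mem
    (φ.open_target.mem_nhds (show p.1 + (0 : ℝ) • X ∈ φ.target by simpa using hp)))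
  refine ⟨fun t => (α t).2, by simp [hα0], min ε δ, lt_min hε hδ, fun t ht => ?_⟩
  have htε : t ∈ Ioo (-ε) ε :=
    ⟨lt_of_le_of_lt (neg_le_neg (min_le_left _ _)) ht.1, lt_of_lt_of_le ht.2 (min_le_left _ _)⟩
  refine ⟨hδt t ?_, ?_⟩
  · rw [Metric.mem_ball, Real.dist_eq, sub_zero]
    exact lt_of_lt_of_le (abs_lt.2 ht) (min_le_right _ _)
  · have h2 : HasDerivAt (fun t => (α t).2) (verticalLift h φ X (α t)) t :=
      (hasFDerivAt_snd (𝕜 := ℝ) (p := α t)).comp_hasDerivAt t (hα t htε)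
    rw [← hfst t htε]
    exact h2

/-- If parallel transport leaves the indicatrices invariant, the Finsler function is constant along
parallel fields over coordinate lines. -/
theorem inCoord_parallel_eq {F : TangentBundle (𝓡 n) M → ℝ} (hF : IsFinslerStructure F)
    (hφ : φ ∈ IsManifold.maximalAtlas (𝓡 n) ∞ M) {h : Metric n M}
    (hinv : LeavesIndicatrixInvariant F (pullbackLeviCivita h))
    {X : Coord n} {p : Coord n × Coord n} (hp : p ∈ slitDomain φ) {ξ : ℝ → Coord n}
    (h0 : ξ 0 = p.2) {ε : ℝ}
    (hξ : ∀ t ∈ Ioo (-ε) ε, p.1 + t • X ∈ φ.target ∧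
      HasDerivAt ξ (verticalLift h φ X (p.1 + t • X, ξ t)) t) {s : ℝ} (hs : s ∈ Ioo (-ε) ε) :
    inCoord φ F (p.1 + s • X, ξ s) = inCoord φ F p := by
  set l := inCoord φ F p with hl
  have hlpos : 0 < l := inCoord_pos hF hφ hp
  have hts : ∀ t ∈ Icc (0 : ℝ) 1, t * s ∈ Ioo (-ε) ε := fun t ht => by
    rw [mem_Ioo, ← abs_lt] at hs ⊢
    rw [abs_mul, abs_of_nonneg ht.1]
    exact lt_of_le_of_lt (mul_le_of_le_one_left (abs_nonneg s) ht.2) hs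
  -- The path in `N` keeps the constant nonzero fibre component `p.2`, since the pulled-back forms
  -- ignore dy; the field is transported separately. The factor `s` fits the time interval to [0,
  -- 1], and `l⁻¹` puts the initial vector on the indicatrix.
  have key := hinv (fun t => natPoint φ (p.1 + (t * s) • X, p.2))
    (fun t => (natPoint φ (p.1 + (t * s) • X, l⁻¹ • ξ (t * s))).snd) ?_ ?_ ?_ ?_
  · have k2 : inCoord φ F (p.1 + ((1 : ℝ) * s) • X, l⁻¹ • ξ (1 * s)) = 1 := key
    rw [one_mul, inCoord_smul hF φ _ _ (inv_pos.2 hlpos)] at k2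
    field_simp at k2
    exact k2
  · refine (contMDiffOn_natPoint hφ).comp
      (f := fun t : ℝ => ((p.1 + (t * s) • X, p.2) : Coord n × Coord n)) ?_
      fun t ht => (hξ _ (hts t ht)).1
    exact (ContDiff.contMDiff (by fun_prop)).contMDiffOn
  · exact fun t ht => natPoint_mem_slit hφ ⟨(hξ _ (hts t ht)).1, hp.2⟩
  · intro t ht
    have hmem : ∀ t ∈ Icc (0 : ℝ) 1, p.1 + (t * s) • X ∈ φ.target := fun t ht =>
      (hξ _ (hts t ht)).1
    have hN : ∀ t ∈ Icc (0 : ℝ) 1, (natCoord φ ⟨(natPoint φ (p.1 + (t * s) • X, p.2)).proj,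
        (natPoint φ (p.1 + (t * s) • X, l⁻¹ • ξ (t * s))).snd⟩)
        = (p.1 + (t * s) • X, l⁻¹ • ξ (t * s)) := fun t ht =>
      natCoord_natPoint (p := (p.1 + (t * s) • X, l⁻¹ • ξ (t * s))) hφ (hmem t ht)
    refine ⟨φ, hφ, φ.map_target (hmem t ht), ?_⟩
    have hder : derivWithin (fun t => natCoord φ (natPoint φ (p.1 + (t * s) • X, p.2))) (Icc 0 1) t
        = (s • X, 0) := by
      have e : HasDerivAt (fun t : ℝ => ((p.1 + (t * s) • X, p.2) : Coord n × Coord n))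
          (s • X, 0) t := by
        have := (((hasDerivAt_id t).mul_const s).smul_const X).const_add p.1
        simpa using this.prodMk (hasDerivAt_const t p.2)
      exact (e.hasDerivWithinAt.congr (fun u hu => natCoord_natPoint hφ (hmem u hu))
        (natCoord_natPoint hφ (hmem t ht))).derivWithin (uniqueDiffOn_Icc_zero_one t ht)
    have hmain : HasDerivAt (fun t : ℝ => l⁻¹ • ξ (t * s))
        (verticalLift h φ (s • X) (p.1 + (t * s) • X, l⁻¹ • ξ (t * s))) t := by
      rw [verticalLift_smul]
      have h1 := (hξ _ (hts t ht)).2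
      have h2 : HasDerivAt (fun t : ℝ => t * s) s t := by
        simpa using (hasDerivAt_id t).mul_const s
      exact (h1.scomp t h2).const_smul l⁻¹
    have hval : (WithLp.toLp 2 fun i => -∑ j, pullbackLeviCivita h φ
          (natCoord φ (natPoint φ (p.1 + (t * s) • X, p.2))) i j
          (derivWithin (fun t => natCoord φ (natPoint φ (p.1 + (t * s) • X, p.2))) (Icc 0 1) t)
        * (natCoord φ ⟨(natPoint φ (p.1 + (t * s) • X, p.2)).proj,
        (natPoint φ (p.1 + (t * s) • X, l⁻¹ • ξ (t * s))).snd⟩).2 j : Coord n)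
        = verticalLift h φ (s • X) (p.1 + (t * s) • X, l⁻¹ • ξ (t * s)) := by
      rw [hder, hN t ht, natCoord_natPoint hφ (hmem t ht)]
      simp only [verticalLift, pullbackLeviCivita, sum_apply, smul_apply, dx_apply, smul_eq_mul]
    rw [hval]
    exact hmain.hasDerivWithinAt.congr (fun u hu => congrArg Prod.snd (hN u hu))
      (congrArg Prod.snd (hN t ht))
  · show inCoord φ F (p.1 + ((0 : ℝ) * s) • X, l⁻¹ • ξ (0 * s)) = 1
    rw [inCoord_smul hF φ _ _ (inv_pos.2 hlpos), zero_mul, zero_smul, add_zero, h0]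
    exact inv_mul_cancel₀ hlpos.ne'

/-- If parallel transport leaves the indicatrices invariant, horizontal vectors annihilate the
square of the Finsler function. -/
theorem fderiv_sq_horizontal {F : TangentBundle (𝓡 n) M → ℝ} (hF : IsFinslerStructure F)
    (hφ : φ ∈ IsManifold.maximalAtlas (𝓡 n) ∞ M) {h : Metric n M}
    (hinv : LeavesIndicatrixInvariant F (pullbackLeviCivita h))
    (X : Coord n) {p : Coord n × Coord n} (hp : p ∈ slitDomain φ) :
    fderiv ℝ (fun q => inCoord φ F q ^ 2) p (X, verticalLift h φ X p) = 0 := by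
  obtain ⟨ξ, h0, ε, hε, hξ⟩ := exists_parallel_curve hφ h X hp.1
  have hd := (differentiableAt_of_smoothOn (isOpen_slitDomain φ)
    ((contDiffOn_inCoord hφ hF.smooth).pow 2) hp).hasFDerivAt
  have hmem : (0 : ℝ) ∈ Ioo (-ε) ε := by simp [hε]
  have hpt : (fun t : ℝ => (p.1 + t • X, ξ t)) 0 = p := by simp [h0]
  have hcurve : HasDerivAt (fun t : ℝ => (p.1 + t • X, ξ t)) (X, verticalLift h φ X p) 0 := by
    have h1 : HasDerivAt (fun t : ℝ => p.1 + t • X) X 0 := by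
      simpa using ((hasDerivAt_id (0 : ℝ)).smul_const X).const_add p.1
    have h2 := (hξ 0 hmem).2
    rw [zero_smul, add_zero, h0] at h2
    exact h1.prodMk h2
  rw [← hpt] at hd
  have h1 := hd.comp_hasDerivAt (0 : ℝ) hcurve
  rw [hpt] at h1
  refine h1.unique ((hasDerivAt_const (0 : ℝ) (inCoord φ F p ^ 2)).congr_of_eventuallyEq ?_)
  filter_upwards [isOpen_Ioo.mem_nhds hmem] with t ht
  simp only [Function.comp_apply, inCoord_parallel_eq hF hφ hinv hp h0 hξ ht]

/-- This is the annihilation of F² by the horizontal lift of the k-th coordinate vector, split into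
its x- and y-parts. -/
theorem pdx_sq_eq {F : TangentBundle (𝓡 n) M → ℝ} (hF : IsFinslerStructure F)
    (hφ : φ ∈ IsManifold.maximalAtlas (𝓡 n) ∞ M) {h : Metric n M}
    (hinv : LeavesIndicatrixInvariant F (pullbackLeviCivita h))
    {p : Coord n × Coord n} (hp : p ∈ slitDomain φ) (k : Fin n) :
    pdx k (fun q => inCoord φ F q ^ 2) p = ∑ r, p.2 r * ∑ l, leviCivita h φ p.1 l r k *
      pdy l (fun q => inCoord φ F q ^ 2) p := by
  have h1 := fderiv_sq_horizontal hF hφ hinv (EuclideanSpace.single k 1) hp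
  have hsplit : ((EuclideanSpace.single k 1, verticalLift h φ (EuclideanSpace.single k 1) p) :
      Coord n × Coord n) = (EuclideanSpace.single k 1, 0)
        + (0, verticalLift h φ (EuclideanSpace.single k 1) p) := by simp
  rw [hsplit, map_add, fderiv_snd_eq_sum_pdy] at h1
  have hV : ∀ l, verticalLift h φ (EuclideanSpace.single k 1) p l
      = -∑ j, leviCivita h φ p.1 l j k * p.2 j := fun l => by
    simp [verticalLift]
  simp only [hV, neg_mul, Finset.sum_neg_distrib] at h1
  rw [pdx, eq_of_sub_eq_zero ((sub_eq_add_neg _ _).trans h1)]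
  simp only [Finset.sum_mul, Finset.mul_sum]
  rw [Finset.sum_comm]
  exact Finset.sum_congr rfl fun r _ => Finset.sum_congr rfl fun l _ => by ring

theorem isChernConnection_pullbackLeviCivita {F : TangentBundle (𝓡 n) M → ℝ}
    (hF : IsFinslerStructure F) {h : Metric n M}
    (hinv : LeavesIndicatrixInvariant F (pullbackLeviCivita h)) :
    IsChernConnection F (pullbackLeviCivita h) where
  torsion_free φ _ p _ i Z W := by
    simp only [pullbackLeviCivita, sum_apply, smul_apply, smul_eq_mul, Finset.sum_sub_distrib,
      Finset.mul_sum]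
    rw [sub_eq_zero, Finset.sum_comm]
    refine Finset.sum_congr rfl fun k _ => Finset.sum_congr rfl fun j _ => ?_
    rw [leviCivita_symm]
    ring
  almost_compatible φ hφ p hp i j := by
    refine almost_compatible_of_horizontal (Γ := leviCivita h φ p.1) (isOpen_slitDomain φ)
      (contDiffOn_inCoord hφ hF.smooth) hp (inCoord_pos hF hφ hp).ne'
      (fun q _ r hr => inCoord_smul hF φ q.1 q.2 hr) (hF.stronglyConvex φ hφ p hp)
      (leviCivita_symm h φ p.1) (fun q hq hqp k => ?_) i j
    -- Points of one fibre share the coefficients Γ, which can thus be taken at `p.1`.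
    rw [pdx_sq_eq hF hφ hinv hq k, hqp]

end Transport
end FinslerGeometry

theorem proposition3p7 {n : ℕ} {M : Type*} [TopologicalSpace M]
    [ChartedSpace (FinslerGeometry.Coord n) M] [IsManifold (𝓡 n) ∞ M]
    (F : TangentBundle (𝓡 n) M → ℝ) (hF : FinslerGeometry.IsFinslerStructure F)
    (hinv : ∃ h : FinslerGeometry.Metric n M,
      FinslerGeometry.LeavesIndicatrixInvariant F (FinslerGeometry.pullbackLeviCivita h)) :
    FinslerGeometry.IsBerwald F := by
  obtain ⟨h, hh⟩ := hinv
  exact ⟨FinslerGeometry.pullbackLeviCivita h,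
    FinslerGeometry.isChernConnection_pullbackLeviCivita hF hh,
    fun φ _ => ⟨FinslerGeometry.leviCivita h φ, fun _ _ _ _ => rfl⟩⟩
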